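/- Let $M=(\mathcal S,\mathcal A,P,r)$ be a finite Markov decision process with transition function $P(y\mid x,a)$ and deterministic real rewards $r(x,a)$. For a stationary policy $\pi:\mathcal S\to\mathcal A$ and an initial state $x$ let $\rho^\pi(x)=\limsup_{n}\frac1n\,\mathbb E_{\pi}\big[\sum_{t=1}^{n}r(x_t,\pi(x_t))\,\big|\,x_1=x\big]$, and let $\rho^*=\max_{\pi,x}\rho^\pi(x)$ be the optimal average reward. A learner interacts with $M$ for $T$ rounds. The rounds are divided into $m$ phases, phase $k$ being $t_k\le t\le t_{k+1}-1$, with $1=t_1\le t_2\le\dots\le t_{m+1}=T+1$; $m$ may be random, and the $t_k$ are stopping times for a filtration $(\mathcal F_t)$ to which the states $x_t$ and the actions $a_t$ are adapted. In phase $k$ the learner plays a policy $\pi_k:\mathcal S\to\mathcal A$, so $a_t=\pi_k(x_t)$, and $\mathbb P(x_{t+1}=y\mid\mathcal F_t)=P(y\mid x_t,a_t)$. The regret is $\mathrm{Reg}_T=\sum_{t=1}^T(\rho^*-r(x_t,a_t))$. At the start of phase $k$ the learner has a reference transition function $\widehat P_k$, finitely many functions $w_{k,i}:\mathcal S\to\mathbb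 R$ and widths $b_{k,i}(x,a)\ge0$ ($i\in\mathcal I$), which define the confidence set $$\mathcal P_k=\Big\{p \text{ a transition function}:\ \sum_{y}w_{k,i}(y)\,|p(y\mid x,a)-\widehat P_k(y\mid x,a)|\le b_{k,i}(x,a)\ \ \forall i,x,a\Big\}.$$ For $\beta:\mathcal S\to\mathbb R$ let $\mathrm{CB}_k^\beta(x,a)\in[0,\infty]$ be the optimal value of $$\min_{c\in\mathbb R,\ \mu\ge0}\ \sum_i b_{k,i}(x,a)\mu_i\quad\text{subject to}\quad \sum_i w_{k,i}(y)\mu_i\ge|\beta(y)+c|\ \ \forall y\in\mathcal S .$$ On the event $\mathcal E=\bigcap_{k=1}^m\{P\in\mathcal P_k\}$, suppose the following for every $k\le m$. * $(\beta_k,\rho_k)$ is an optimal solution of the problem of minimizing $\rho$ over $(\beta,\rho)$ subject to $\beta(x)+\rho\ge r(x,a)+\mathrm{CB}_k^\beta(x,a)+\sum_y\widehat P_k(y\mid x,a)\beta(y)$ for all $x,a$. (Everywhere, $\beta_k$ is measurable with respect to $\mathcal F_{t_k}$.) * With $\mathrm{CB}_k=\mathrm{CB}_k^{\beta_k}$,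 the policy $\pi_k$ satisfies the optimality equation $\beta_k(x)+\rho_k=r(x,\pi_k(x))+\mathrm{CB}_k(x,\pi_k(x))+\sum_y\widehat P_k(y\mid x,\pi_k(x))\beta_k(y)$ at the states $x$ visited in phase $k$. * $\mathrm{sp}(\beta_k)=\max_x\beta_k(x)-\min_x\beta_k(x)\le D$, where $D$ is a constant. Let $\mathrm{CP}_k(x,a)=\sum_y(\widehat P_k(y\mid x,a)-P(y\mid x,a))\beta_k(y)$. Then for every $\delta\ge\frac1{2T^2}$ the probability that $\mathcal E$ occurs and the bound $$\mathrm{Reg}_T\le\sum_{k=1}^m\sum_{t=t_k}^{t_{k+1}-1}\mathrm{CB}_k(x_t,\pi_k(x_t))+\sum_{k=1}^m\sum_{t=t_k}^{t_{k+1}-1}\mathrm{CP}_k(x_t,\pi_k(x_t))+Dm+D\sqrt{T\log T}$$ fails is at most $2\delta$. Moreover, for every $\delta\in(0,1)$ the same holds with $D\sqrt{T\log(1/\delta)}$ in place of $D\sqrt{T\log T}$. -/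

import Mathlib

open MeasureTheory

noncomputable section

namespace AvgReward

/-- `p x a y` is a transition function: `p x a` is a probability vector for every `x, a`. -/
def IsTransition {S A : Type*} [Fintype S] (p : S → A → S → ℝ) : Prop :=
  (∀ x a y, 0 ≤ p x a y) ∧ ∀ x a, ∑ y, p x a y = 1

/-- A finite Markov decision process with deterministic rewards. -/
structure MDP (S A : Type*) [Fintype S] where
  /-- `P x a y` is the probability of moving to `y` after playing `a` in `x`. -/
  P : S → A → S → ℝ
  r : S → A → ℝ
  isTransition : IsTransition P

section Gain

variable {S A : Type*} [Fintype S] [DecidableEq S]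

/-- Transition matrix of the Markov chain induced by a stationary policy. -/
def MDP.policyMatrix (M : MDP S A) (π : S → A) : Matrix S S ℝ :=
  Matrix.of fun x y => M.P x (π x) y

/-- Expected reward of `π` in round `t` (rounds counted from `0`) when started in `x`. -/
def MDP.expectedReward (M : MDP S A) (π : S → A) (t : ℕ) (x : S) : ℝ :=
  ((M.policyMatrix π ^ t).mulVec fun z => M.r z (π z)) x

/-- Long-run average reward of a stationary policy from the initial state `x`. -/
def MDP.gain (M : MDP S A) (π : S → A) (x : S) : ℝ :=
  Filter.limsup (fun n : ℕ => (∑ t ∈ Finset.range n, M.expectedReward π t x) / n) Filter.atTop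

/-- The optimal average reward: the maximum of the gain over stationary policies and initial
states. If the optimal gain does not depend on the initial state, it is that common value. -/
def MDP.optGain (M : MDP S A) : ℝ := ⨆ π : S → A, ⨆ x : S, M.gain π x

end Gain

/-- The data of an optimistic linear program: a reference transition function,
constraint-aggregation functions `w i` and confidence widths `b i`. -/
structure ConfModel (S A I : Type*) [Fintype S] where
  Phat : S → A → S → ℝ
  isTransition : IsTransition Phat
  w : I → S → ℝ
  b : I → S → A → ℝ
  b_nonneg : ∀ i x a, 0 ≤ b i x a

section Dual

variable {S A I : Type*} [Fintype S] [Fintype I]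

/-- The set of transition functions that satisfy the aggregated confidence constraints. -/
def ConfModel.confSet (C : ConfModel S A I) : Set (S → A → S → ℝ) :=
  {p | IsTransition p ∧ ∀ i x a, ∑ y, C.w i y * |p x a y - C.Phat x a y| ≤ C.b i x a}

/-- Objective values of the linear program that defines the bonus:
`∑ i, b i x a * μ i` over `c : ℝ`, `μ ≥ 0` with `∑ i, w i y * μ i ≥ |β y + c|` for all `y`. -/
def ConfModel.bonusValues (C : ConfModel S A I) (β : S → ℝ) (x : S) (a : A) : Set ℝ :=
  {v | ∃ (c : ℝ) (μ : I → ℝ), (∀ i, 0 ≤ μ i) ∧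
    (∀ y, |β y + c| ≤ ∑ i, C.w i y * μ i) ∧ v = ∑ i, C.b i x a * μ i}

/-- The bonus `CB(x, a)`: the optimal value of that program. It is the actual minimum
when the program is feasible; an infeasible program (value `+∞`) is excluded in `DualFeasible`. -/
def ConfModel.CB (C : ConfModel S A I) (β : S → ℝ) (x : S) (a : A) : ℝ :=
  sInf (C.bonusValues β x a)

/-- Feasibility for the dual program: minimize `ρ` subject to
`β x + ρ ≥ r x a + CB x a + ∑ y, Phat x a y * β y` for all `x, a`.
The bonus is the one induced by `β`, and it has to be finite. -/
def ConfModel.DualFeasible (C : ConfModel S A I) (r : S → A → ℝ) (β : S → ℝ) (ρ : ℝ) : Prop :=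
  ∀ x a, (C.bonusValues β x a).Nonempty ∧
    r x a + C.CB β x a + ∑ y, C.Phat x a y * β y ≤ β x + ρ

/-- `(β, ρ)` is an optimal solution of the dual program. -/
def ConfModel.DualOptimal (C : ConfModel S A I) (r : S → A → ℝ) (β : S → ℝ) (ρ : ℝ) : Prop :=
  C.DualFeasible r β ρ ∧ ∀ β' ρ', C.DualFeasible r β' ρ' → ρ ≤ ρ'

/-- The action `a` is optimal in `x` with respect to the dual solution `(β, ρ)`:
it attains equality in the dual constraint (the optimality equation). -/
def ConfModel.OptimalAction (C : ConfModel S A I) (r : S → A → ℝ) (β : S → ℝ) (ρ : ℝ)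
    (x : S) (a : A) : Prop :=
  β x + ρ = r x a + C.CB β x a + ∑ y, C.Phat x a y * β y

/-- `CP(x, a) = ∑ y, (Phat(y | x, a) - P(y | x, a)) β(y)`. -/
def ConfModel.CP (C : ConfModel S A I) (P : S → A → S → ℝ) (β : S → ℝ) (x : S) (a : A) : ℝ :=
  ∑ y, (C.Phat x a y - P x a y) * β y

end Dual

/-- The span `max β - min β`. -/
def span {S : Type*} (β : S → ℝ) : ℝ := (⨆ x, β x) - ⨅ x, β x

/-- A run of `T` rounds `t = 0, …, T - 1` in the MDP `M`, divided into the phases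
`k = 0, …, m - 1`: phase `k` consists of the rounds `τ k ≤ t < τ (k + 1)`, and the policy `π k` is
played in it. The phase boundaries and the number of phases may depend on the history, which
is recorded by the filtration `ℱ`; the function `β k` is computed from the history at the beginning
of phase `k`; and the next state is drawn from `P(· | x_t, a_t)` given the history. -/
structure IsPhasedRun {S A Ω : Type*} [Fintype S] {mΩ : MeasurableSpace Ω} (μ : Measure Ω)
    (ℱ : Filtration ℕ mΩ) (M : MDP S A) (T : ℕ) (X : ℕ → Ω → S) (act : ℕ → Ω → A)
    (τ : ℕ → Ω → ℕ) (m : Ω → ℕ) (π : ℕ → Ω → S → A) (β : ℕ → Ω → S → ℝ) : Prop where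
  state_adapted : ∀ t ≤ T, ∀ x, MeasurableSet[ℱ t] {ω | X t ω = x}
  act_adapted : ∀ t < T, ∀ a, MeasurableSet[ℱ t] {ω | act t ω = a}
  stopping : ∀ k, IsStoppingTime ℱ (fun ω => (τ k ω : WithTop ℕ))
  start : ∀ ω, τ 0 ω = 0
  mono : ∀ ω, Monotone fun k => τ k ω
  finish : ∀ ω, τ (m ω) ω = T
  dual_measurable : ∀ k, Measurable[(stopping k).measurableSpace] (β k)
  act_eq : ∀ ω, ∀ k < m ω, ∀ t ∈ Finset.Ico (τ k ω) (τ (k + 1) ω), act t ω = π k ω (X t ω)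
  transition : ∀ t < T, ∀ y,
    μ[{ω | X (t + 1) ω = y}.indicator (fun _ => (1 : ℝ)) | ℱ t]
      =ᵐ[μ] fun ω => M.P (X t ω) (act t ω) y

/-- The regret `∑_t (ρ* - r(x_t, a_t))`. -/
def regret {S A Ω : Type*} [Fintype S] [DecidableEq S] (M : MDP S A) (T : ℕ)
    (X : ℕ → Ω → S) (act : ℕ → Ω → A) (ω : Ω) : ℝ :=
  ∑ t ∈ Finset.range T, (M.optGain - M.r (X t ω) (act t ω))

/-- The event that the true transition function lies in the confidence sets of all phases. -/
def goodEvent {S A I Ω : Type*} [Fintype S] [Fintype I] (M : MDP S A)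
    (C : ℕ → Ω → ConfModel S A I) (m : Ω → ℕ) : Set Ω :=
  {ω | ∀ k < m ω, M.P ∈ (C k ω).confSet}

/-- `∑_k ∑_{t in phase k} f k (x_t) (π_k (x_t))`. -/
def phaseSum {S A Ω : Type*} (X : ℕ → Ω → S) (τ : ℕ → Ω → ℕ) (m : Ω → ℕ)
    (π : ℕ → Ω → S → A) (f : ℕ → Ω → S → A → ℝ) (ω : Ω) : ℝ :=
  ∑ k ∈ Finset.range (m ω), ∑ t ∈ Finset.Ico (τ k ω) (τ (k + 1) ω),
    f k ω (X t ω) (π k ω (X t ω))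

end AvgReward

end

/-!
By weak duality the bonus `CB` dominates `∑ y, (P - Phat) β`, so on the good event a dual feasible
pair `(β, ρ)` satisfies the Bellman inequality `r + P β ≤ β + ρ` of the true process. Iterating it
bounds the gain of every policy, whence `ρ* ≤ ρ`; the optimality equation then gives, in each round,
`ρ* - r ≤ CB + CP + (P β - β)`.

Write `P β (X t) - β (X t)` as `(β (X (t + 1)) - β (X t)) + (P β (X t) - β (X (t + 1)))`. The first
term telescopes within a phase to at most the span `D`. The second is a martingale difference
which, given the past, ranges over an interval of length `D`; by the Azuma–Hoeffding inequality its
sum is sub-Gaussian with variance proxy `T * D ^ 2 / 4`, so it exceeds `D * √(T * L)` with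
probability at most `exp (-2 * L)`.
-/

open ProbabilityTheory

noncomputable section

namespace AvgReward

section WeakDuality

variable {S A I : Type*} [Fintype S] [Fintype I]

theorem ConfModel.sum_sub_mul_le_CB (C : ConfModel S A I) {p : S → A → S → ℝ}
    (hp : p ∈ C.confSet) {β : S → ℝ} {x : S} {a : A} (hne : (C.bonusValues β x a).Nonempty) :
    ∑ y, (p x a y - C.Phat x a y) * β y ≤ C.CB β x a := by
  refine le_csInf hne ?_
  rintro v ⟨c, μ, hμ, hfeas, rfl⟩
  -- `p` and `Phat` have the same total mass, so `β` may be shifted by the constant `c`.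
  calc ∑ y, (p x a y - C.Phat x a y) * β y
      = ∑ y, (p x a y - C.Phat x a y) * (β y + c) := by
        simp only [mul_add, Finset.sum_add_distrib, ← Finset.sum_mul, Finset.sum_sub_distrib,
          hp.1.2, C.isTransition.2, sub_self, zero_mul, add_zero]
    _ ≤ ∑ y, |p x a y - C.Phat x a y| * ∑ i, C.w i y * μ i := by
        refine Finset.sum_le_sum fun y _ => (le_abs_self _).trans ?_
        rw [abs_mul]
        exact mul_le_mul_of_nonneg_left (hfeas y) (abs_nonneg _)
    _ = ∑ i, (∑ y, C.w i y * |p x a y - C.Phat x a y|) * μ i := by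
        simp only [Finset.mul_sum, Finset.sum_mul]
        rw [Finset.sum_comm]
        exact Finset.sum_congr rfl fun i _ => Finset.sum_congr rfl fun y _ => by ring
    _ ≤ ∑ i, C.b i x a * μ i :=
        Finset.sum_le_sum fun i _ => mul_le_mul_of_nonneg_right (hp.2 i x a) (hμ i)

theorem ConfModel.DualFeasible.bellman_le {C : ConfModel S A I} {r : S → A → ℝ} {β : S → ℝ}
    {ρ : ℝ} (h : C.DualFeasible r β ρ) {p : S → A → S → ℝ} (hp : p ∈ C.confSet) (x : S) (a : A) :
    r x a + ∑ y, p x a y * β y ≤ β x + ρ := by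
  obtain ⟨hne, hle⟩ := h x a
  have hbonus := C.sum_sub_mul_le_CB hp hne
  simp only [sub_mul, Finset.sum_sub_distrib] at hbonus
  linarith

end WeakDuality

section Span

variable {S : Type*} [Finite S]

theorem sub_le_span (β : S → ℝ) (y z : S) : β y - β z ≤ span β :=
  sub_le_sub (le_ciSup (Set.finite_range β).bddAbove y) (ciInf_le (Set.finite_range β).bddBelow z)

theorem span_nonneg [Nonempty S] (β : S → ℝ) : 0 ≤ span β := by
  simpa only [sub_self] using sub_le_span β (Classical.arbitrary S) (Classical.arbitrary S)

end Span

section Gain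

theorem limsup_average_le {f : ℕ → ℝ} {B C ρ : ℝ} (hB : ∀ t, B ≤ f t)
    (hsum : ∀ n : ℕ, ∑ t ∈ Finset.range n, f t ≤ C + n * ρ) :
    Filter.limsup (fun n : ℕ => (∑ t ∈ Finset.range n, f t) / n) Filter.atTop ≤ ρ := by
  have hlim : Filter.Tendsto (fun n : ℕ => C / (n : ℝ) + ρ) Filter.atTop (nhds ρ) := by
    simpa only [zero_add] using (tendsto_const_div_atTop_nhds_zero_nat C).add_const ρ
  have hlower : ∀ᶠ n : ℕ in Filter.atTop, B ≤ (∑ t ∈ Finset.range n, f t) / n := by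
    filter_upwards [Filter.eventually_gt_atTop 0] with n hn
    rw [le_div_iff₀ (Nat.cast_pos.2 hn), mul_comm]
    simpa only [Finset.card_range, nsmul_eq_mul] using
      Finset.card_nsmul_le_sum (Finset.range n) f B fun t _ => hB t
  rw [← hlim.limsup_eq]
  refine Filter.limsup_le_limsup ?_ (Filter.isCoboundedUnder_le_of_eventually_le _ hlower)
    hlim.isBoundedUnder_le
  filter_upwards [Filter.eventually_gt_atTop 0] with n hn
  have hn' : (0 : ℝ) < n := Nat.cast_pos.2 hn
  rw [div_le_iff₀ hn', add_mul, div_mul_cancel₀ _ hn'.ne', mul_comm ρ]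
  exact hsum n

variable {S A : Type*} [Fintype S] [DecidableEq S]

theorem mulVec_le_mulVec_of_mem_rowStochastic {Q : Matrix S S ℝ} (hQ : Q ∈ Matrix.rowStochastic ℝ S)
    {f g : S → ℝ} (hfg : f ≤ g) : Q.mulVec f ≤ Q.mulVec g :=
  fun x => Finset.sum_le_sum fun y _ => mul_le_mul_of_nonneg_left (hfg y) (hQ.1 x y)

theorem mulVec_const_of_mem_rowStochastic {Q : Matrix S S ℝ} (hQ : Q ∈ Matrix.rowStochastic ℝ S)
    (c : ℝ) : Q.mulVec (fun _ => c) = fun _ => c := by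
  funext x
  simp only [Matrix.mulVec, dotProduct, ← Finset.sum_mul, Matrix.sum_row_of_mem_rowStochastic hQ,
    one_mul]

namespace MDP

variable (M : MDP S A)

theorem policyMatrix_pow_mem_rowStochastic (π : S → A) (t : ℕ) :
    M.policyMatrix π ^ t ∈ Matrix.rowStochastic ℝ S := by
  have hone : M.policyMatrix π ∈ Matrix.rowStochastic ℝ S :=
    Matrix.mem_rowStochastic_iff_sum.2
      ⟨fun x => M.isTransition.1 x (π x), fun x => M.isTransition.2 x (π x)⟩
  exact pow_mem hone t

theorem le_expectedReward {π : S → A} {B : ℝ} (hB : ∀ z, B ≤ M.r z (π z)) (t : ℕ) (x : S) :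
    B ≤ M.expectedReward π t x := by
  have hQ := M.policyMatrix_pow_mem_rowStochastic π t
  have hle := mulVec_le_mulVec_of_mem_rowStochastic hQ hB x
  rwa [mulVec_const_of_mem_rowStochastic hQ] at hle

variable {M} {β : S → ℝ} {ρ : ℝ} {π : S → A}

theorem expectedReward_le_of_bellman
    (h : ∀ x, M.r x (π x) + ∑ y, M.P x (π x) y * β y ≤ β x + ρ) (t : ℕ) (x : S) :
    M.expectedReward π t x ≤ (M.policyMatrix π ^ t).mulVec β x
      - (M.policyMatrix π ^ (t + 1)).mulVec β x + ρ := by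
  have hQ := M.policyMatrix_pow_mem_rowStochastic π t
  have hreward :
      (fun z => M.r z (π z)) ≤ β - (M.policyMatrix π).mulVec β + fun _ => ρ := fun z => by
    change _ ≤ β z - ∑ y, M.P z (π z) y * β y + ρ
    linarith [h z]
  have hle := mulVec_le_mulVec_of_mem_rowStochastic hQ hreward x
  rwa [Matrix.mulVec_add, Matrix.mulVec_sub, Matrix.mulVec_mulVec, ← pow_succ,
    mulVec_const_of_mem_rowStochastic hQ] at hle

theorem sum_expectedReward_le_of_bellman
    (h : ∀ x, M.r x (π x) + ∑ y, M.P x (π x) y * β y ≤ β x + ρ) (n : ℕ) (x : S) :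
    ∑ t ∈ Finset.range n, M.expectedReward π t x ≤ span β + n * ρ := by
  have hlower : ⨅ y, β y ≤ (M.policyMatrix π ^ n).mulVec β x := by
    have hQ := M.policyMatrix_pow_mem_rowStochastic π n
    have hle := mulVec_le_mulVec_of_mem_rowStochastic hQ
      (ciInf_le (Set.finite_range β).bddBelow) x
    rwa [mulVec_const_of_mem_rowStochastic hQ] at hle
  calc ∑ t ∈ Finset.range n, M.expectedReward π t x
      ≤ ∑ t ∈ Finset.range n, ((M.policyMatrix π ^ t).mulVec β x
          - (M.policyMatrix π ^ (t + 1)).mulVec β x + ρ) :=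
        Finset.sum_le_sum fun t _ => expectedReward_le_of_bellman h t x
    _ = β x - (M.policyMatrix π ^ n).mulVec β x + n * ρ := by
        rw [Finset.sum_add_distrib,
          Finset.sum_range_sub' fun t => (M.policyMatrix π ^ t).mulVec β x, pow_zero,
          Matrix.one_mulVec, Finset.sum_const, Finset.card_range, nsmul_eq_mul]
    _ ≤ span β + n * ρ := by
        have hupper : β x ≤ ⨆ y, β y := le_ciSup (Set.finite_range β).bddAbove x
        rw [span]
        linarith

theorem gain_le_of_bellman (h : ∀ x, M.r x (π x) + ∑ y, M.P x (π x) y * β y ≤ β x + ρ) (x : S) :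
    M.gain π x ≤ ρ :=
  limsup_average_le
    (M.le_expectedReward (ciInf_le (Set.finite_range fun z => M.r z (π z)).bddBelow) · x)
    (sum_expectedReward_le_of_bellman h · x)

end MDP

namespace ConfModel.DualFeasible

variable {I : Type*} [Fintype I] {M : MDP S A} {C : ConfModel S A I} {β : S → ℝ} {ρ : ℝ}

theorem optGain_le [Nonempty S] [Nonempty A] (h : C.DualFeasible M.r β ρ)
    (hP : M.P ∈ C.confSet) : M.optGain ≤ ρ :=
  ciSup_le fun π => ciSup_le fun x =>
    MDP.gain_le_of_bellman (fun x => h.bellman_le hP x (π x)) x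

theorem optGain_sub_reward_le (h : C.DualFeasible M.r β ρ) (hP : M.P ∈ C.confSet) {x : S} {a : A}
    (hopt : C.OptimalAction M.r β ρ x a) :
    M.optGain - M.r x a ≤ C.CB β x a + C.CP M.P β x a + (∑ y, M.P x a y * β y - β x) := by
  have : Nonempty S := ⟨x⟩
  have : Nonempty A := ⟨a⟩
  have hgain := h.optGain_le hP
  rw [OptimalAction] at hopt
  simp only [CP, sub_mul, Finset.sum_sub_distrib]
  linarith

end ConfModel.DualFeasible

end Gain

section Azuma

open scoped NNReal

variable {Ω : Type*} {mΩ : MeasurableSpace Ω} {μ : Measure Ω}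

-- Conditioning goes through `condDistrib` onto `ℝ`, because `HasCondSubgaussianMGF` would require
-- `Ω` to be a standard Borel space.
theorem hasSubgaussianMGF_add_of_condDistrib [IsFiniteMeasure μ] {E : Type*}
    {mE : MeasurableSpace E} {W : Ω → E} {f : E → ℝ} {Y : Ω → ℝ} {cX cY : ℝ≥0}
    (hW : Measurable W) (hf : AEMeasurable f (μ.map W)) (hY : AEMeasurable Y μ)
    (hsubX : HasSubgaussianMGF (f ∘ W) cX μ)
    (hsubY : Kernel.HasSubgaussianMGF id cY (condDistrib Y W μ) (μ.map W)) :
    HasSubgaussianMGF (fun ω => f (W ω) + Y ω) (cX + cY) μ := by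
  have hsubf : HasSubgaussianMGF f cX (μ.map W) := by
    rw [← HasSubgaussianMGF.id_map_iff hf, AEMeasurable.map_map_of_aemeasurable hf hW.aemeasurable]
    exact (HasSubgaussianMGF.id_map_iff (hf.comp_aemeasurable hW.aemeasurable)).2 hsubX
  suffices hprod : HasSubgaussianMGF (fun p : E × ℝ => f p.1 + p.2) (cX + cY)
      (μ.map fun ω => (W ω, Y ω)) from
    hprod.of_map (hW.aemeasurable.prodMk hY)
  rw [HasSubgaussianMGF_iff_kernel] at hsubf ⊢
  have hsubY' : Kernel.HasSubgaussianMGF id cY (condDistrib Y W μ)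
      (Kernel.const Unit (μ.map W) ∘ₘ Measure.dirac ()) := by simpa
  convert! hsubf.add_comp hsubY'
  ext
  rw [Kernel.const_apply, ← Measure.compProd, compProd_map_condDistrib hY]

theorem kernel_hasSubgaussianMGF_of_mem_Icc {E : Type*} {mE : MeasurableSpace E} {ν : Measure E}
    [IsFiniteMeasure ν] {κ : Kernel E ℝ} [IsMarkovKernel κ] {l : E → ℝ} {d : ℝ}
    (hrange : ∀ᵐ w ∂ν, ∀ᵐ y ∂κ w, y ∈ Set.Icc (l w) (l w + d))
    (hmean : ∀ᵐ w ∂ν, ∫ y, y ∂κ w = 0) :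
    Kernel.HasSubgaussianMGF id ((‖d‖₊ / 2) ^ 2) κ ν := by
  -- The interval contains the mean `0`, so it lies in `[-d, d]` wherever `l w` is.
  have hbound : ∀ᵐ y ∂κ ∘ₘ ν, y ∈ Set.Icc (-d) d := by
    refine Measure.ae_comp_of_ae_ae measurableSet_Icc ?_
    filter_upwards [hrange, hmean] with w hw hw0
    have hmem := (convex_Icc (l w) (l w + d)).integral_mem isClosed_Icc hw
      (Integrable.of_mem_Icc _ _ aemeasurable_id hw)
    rw [hw0] at hmem
    filter_upwards [hw] with y hy
    exact ⟨by linarith [hy.1, hmem.2], by linarith [hy.2, hmem.1]⟩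
  refine ⟨fun t => integrable_exp_mul_of_mem_Icc aemeasurable_id hbound, ?_⟩
  filter_upwards [hrange, hmean] with w hw hw0
  have hsub := hasSubgaussianMGF_of_mem_Icc_of_integral_eq_zero (X := id) aemeasurable_id hw hw0
  rw [add_sub_cancel_left] at hsub
  exact hsub.mgf_le

theorem condDistrib_hasSubgaussianMGF_of_mem_Icc [IsFiniteMeasure μ] {E : Type*}
    {mE : MeasurableSpace E} {W : Ω → E} {Y : Ω → ℝ} {l : E → ℝ} {d : ℝ} (hW : Measurable W)
    (hl : Measurable l) (hY : Integrable Y μ) (hmean : μ[Y | mE.comap W] =ᵐ[μ] 0)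
    (hrange : ∀ᵐ ω ∂μ, Y ω ∈ Set.Icc (l (W ω)) (l (W ω) + d)) :
    Kernel.HasSubgaussianMGF id ((‖d‖₊ / 2) ^ 2) (condDistrib Y W μ) (μ.map W) := by
  refine kernel_hasSubgaussianMGF_of_mem_Icc (l := l) ?_ ?_
  · refine Measure.ae_ae_of_ae_compProd (p := fun q : E × ℝ => q.2 ∈ Set.Icc (l q.1) (l q.1 + d)) ?_
    rw [compProd_map_condDistrib hY.aemeasurable,
      ae_map_iff (hW.aemeasurable.prodMk hY.aemeasurable)]
    · exact hrange
    · exact (measurableSet_le (hl.comp measurable_fst) measurable_snd).inter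
        (measurableSet_le measurable_snd ((hl.comp measurable_fst).add_const d))
  · have hmeas : StronglyMeasurable fun w => ∫ y, y ∂condDistrib Y W μ w :=
      (stronglyMeasurable_id.comp_measurable measurable_snd).integral_condDistrib
    rw [ae_map_iff hW.aemeasurable (measurableSet_eq_fun hmeas.measurable measurable_const)]
    filter_upwards [hmean, condExp_ae_eq_integral_condDistrib' hW hY] with ω hzero hint
    exact hint.symm.trans hzero

theorem condExp_sub_condExp_ae_eq_zero [IsFiniteMeasure μ] {m : MeasurableSpace Ω}
    {Z : Ω → ℝ} (hm : m ≤ mΩ) (hZ : Integrable Z μ) :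
    μ[Z - μ[Z | m] | m] =ᵐ[μ] 0 := by
  refine (condExp_sub hZ integrable_condExp m).trans ?_
  rw [condExp_of_stronglyMeasurable hm stronglyMeasurable_condExp integrable_condExp, sub_self]

theorem hasSubgaussianMGF_sum_sub_condExp [IsProbabilityMeasure μ] {ℱ : Filtration ℕ mΩ}
    {Z : ℕ → Ω → ℝ} {a b : ℝ} {n : ℕ} (hZ : ∀ t < n, Measurable[ℱ (t + 1)] (Z t))
    (hab : ∀ t < n, ∀ ω, Z t ω ∈ Set.Icc a b) :
    HasSubgaussianMGF (fun ω => ∑ t ∈ Finset.range n, (Z t ω - (μ[Z t | ℱ t]) ω))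
      (n * (‖b - a‖₊ / 2) ^ 2) μ := by
  induction n with
  | zero => simp
  | succ n ih =>
    have hn := n.lt_succ_self
    have hZn : Measurable (Z n) := (hZ n hn).mono (ℱ.le _) le_rfl
    have hint : Integrable (Z n) μ := .of_mem_Icc a b hZn.aemeasurable (ae_of_all _ (hab n hn))
    have hmean : μ[Z n - μ[Z n | ℱ n] | (ℱ n).comap id] =ᵐ[μ] 0 := by
      rw [MeasurableSpace.comap_id]
      exact condExp_sub_condExp_ae_eq_zero (ℱ.le n) hint
    have hpast : Measurable[ℱ n] fun ω => ∑ t ∈ Finset.range n, (Z t ω - (μ[Z t | ℱ t]) ω) :=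
      Finset.measurable_fun_sum _ fun t ht => by
        have htn := Finset.mem_range.1 ht
        exact ((hZ t (htn.trans hn)).mono (ℱ.mono htn) le_rfl).sub
          (stronglyMeasurable_condExp.measurable.mono (ℱ.mono htn.le) le_rfl)
    have hnext := condDistrib_hasSubgaussianMGF_of_mem_Icc (mE := ℱ n) (W := id)
      (l := fun ω => a - (μ[Z n | ℱ n]) ω) (d := b - a) (measurable_id'' (ℱ.le n))
      (stronglyMeasurable_condExp.measurable.const_sub a) (hint.sub integrable_condExp) hmean
      (ae_of_all _ fun ω => by
        obtain ⟨h1, h2⟩ := hab n hn ω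
        simp only [Set.mem_Icc, id, Pi.sub_apply]
        constructor <;> linarith)
    have hsum := hasSubgaussianMGF_add_of_condDistrib (mE := ℱ n) (measurable_id'' (ℱ.le n))
      hpast.aemeasurable (hint.sub integrable_condExp).aemeasurable
      (ih (fun t ht => hZ t (ht.trans hn)) fun t ht => hab t (ht.trans hn)) hnext
    simp only [Finset.sum_range_succ]
    rw [Nat.cast_succ, add_one_mul]
    exact hsum

theorem measure_sqrt_lt_le [IsProbabilityMeasure μ] {X : Ω → ℝ} {c : ℝ≥0}
    (hX : HasSubgaussianMGF X c μ) {u : ℝ} (hu : 0 ≤ u) :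
    μ {ω | √(2 * c * u) < X ω} ≤ ENNReal.ofReal (Real.exp (-u)) := by
  rcases eq_or_ne c 0 with rfl | hc
  · have hnull : μ {ω | √(2 * (0 : ℝ≥0) * u) < X ω} = 0 := by
      refine measure_mono_null (fun ω hω => ?_) (ae_iff.1 hX.ae_eq_zero_of_hasSubgaussianMGF_zero)
      exact ((Real.sqrt_nonneg _).trans_lt hω).ne'
    exact hnull.trans_le zero_le
  · have : (0 : ℝ) < c := NNReal.coe_pos.2 (pos_iff_ne_zero.2 hc)
    calc μ {ω | √(2 * c * u) < X ω} ≤ μ {ω | √(2 * c * u) ≤ X ω} :=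
          measure_mono fun ω hω => (show √(2 * c * u) < X ω from hω).le
      _ = ENNReal.ofReal (μ.real {ω | √(2 * c * u) ≤ X ω}) := (ofReal_measureReal).symm
      _ ≤ ENNReal.ofReal (Real.exp (-u)) := by
          refine ENNReal.ofReal_le_ofReal ((hX.measure_ge_le (Real.sqrt_nonneg _)).trans_eq ?_)
          rw [Real.sq_sqrt (by positivity)]
          field_simp

end Azuma

section Noise

variable {S Ω : Type*} {mΩ : MeasurableSpace Ω} {μ : Measure Ω} {Y : Ω → S}

theorem measurable_eval_of_measurableSet [Countable S] {f : Ω → S → ℝ}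
    (hf : ∀ y, Measurable fun ω => f ω y) (hY : ∀ y, MeasurableSet {ω | Y ω = y}) :
    Measurable fun ω => f ω (Y ω) := by
  let _ : MeasurableSpace S := ⊤
  have hYmeas : Measurable Y := measurable_to_countable' hY
  exact (measurable_from_prod_countable_left (f := fun p : Ω × S => f p.1 p.2) hf).comp
    (measurable_id.prodMk hYmeas)

variable [Fintype S]

theorem condExp_eval_ae_eq_sum [IsFiniteMeasure μ] {m : MeasurableSpace Ω} {f q : Ω → S → ℝ}
    (hf : ∀ y, Measurable[m] fun ω => f ω y) (hfint : ∀ y, Integrable (fun ω => f ω y) μ)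
    (hY : ∀ y, MeasurableSet[mΩ] {ω | Y ω = y})
    (hq : ∀ y, μ[{ω | Y ω = y}.indicator (fun _ => (1 : ℝ)) | m] =ᵐ[μ] fun ω => q ω y) :
    μ[fun ω => f ω (Y ω) | m] =ᵐ[μ] fun ω => ∑ y, q ω y * f ω y := by
  classical
  let e : S → Ω → ℝ := fun y => {ω | Y ω = y}.indicator fun _ => 1
  have he : ∀ y, Integrable (e y) μ := fun y => (integrable_const 1).indicator (hY y)
  have hprod : ∀ y, Integrable ((fun ω => f ω y) * e y) μ := fun y => by
    have hmul : (fun ω => f ω y) * e y = {ω | Y ω = y}.indicator fun ω => f ω y := by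
      ext ω
      simp [e, Set.indicator_apply]
    rw [hmul]
    exact (hfint y).indicator (hY y)
  have hterm : ∀ y, μ[(fun ω => f ω y) * e y | m] =ᵐ[μ] fun ω => q ω y * f ω y := fun y => by
    filter_upwards [hq y,
      condExp_mul_of_stronglyMeasurable_left (hf y).stronglyMeasurable (hprod y) (he y)]
      with ω hqω hpull
    rw [hpull, Pi.mul_apply, hqω, mul_comm]
  have hsum : (fun ω => f ω (Y ω)) = ∑ y, (fun ω => f ω y) * e y := by
    ext ω
    simp [e, Set.indicator_apply]
  rw [hsum]
  filter_upwards [condExp_finsetSum (fun y _ => hprod y) m, ae_all_iff.2 hterm] with ω hω hterms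
  rw [hω, Finset.sum_apply]
  exact Finset.sum_congr rfl fun y _ => hterms y

/-- The noise collected in `T` rounds by the values `V t (X (t + 1))` at the next state, when
`q t ω` is the law of that state given the past: expected value minus observed value. -/
def transitionNoise (q V : ℕ → Ω → S → ℝ) (X : ℕ → Ω → S) (T : ℕ) (ω : Ω) : ℝ :=
  ∑ t ∈ Finset.range T, (∑ y, q t ω y * V t ω y - V t ω (X (t + 1) ω))

theorem hasSubgaussianMGF_transitionNoise [IsProbabilityMeasure μ] {ℱ : Filtration ℕ mΩ}
    {q V : ℕ → Ω → S → ℝ} {X : ℕ → Ω → S} {T : ℕ} {a b : ℝ}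
    (hX : ∀ t < T, ∀ y, MeasurableSet[ℱ (t + 1)] {ω | X (t + 1) ω = y})
    (hq : ∀ t < T, ∀ y, μ[{ω | X (t + 1) ω = y}.indicator (fun _ => (1 : ℝ)) | ℱ t]
      =ᵐ[μ] fun ω => q t ω y)
    (hV : ∀ t < T, ∀ y, Measurable[ℱ t] fun ω => V t ω y)
    (hab : ∀ t < T, ∀ ω y, V t ω y ∈ Set.Icc a b) :
    HasSubgaussianMGF (transitionNoise q V X T) (T * (‖b - a‖₊ / 2) ^ 2) μ := by
  have hmeas : ∀ t < T, Measurable[ℱ (t + 1)] fun ω => V t ω (X (t + 1) ω) := fun t ht =>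
    measurable_eval_of_measurableSet (mΩ := ℱ (t + 1))
      (fun y => (hV t ht y).mono (ℱ.mono t.le_succ) le_rfl) (hX t ht)
  have hcond : ∀ t < T, μ[fun ω => V t ω (X (t + 1) ω) | ℱ t]
      =ᵐ[μ] fun ω => ∑ y, q t ω y * V t ω y := fun t ht =>
    condExp_eval_ae_eq_sum (hV t ht)
      (fun y => .of_mem_Icc a b ((hV t ht y).mono (ℱ.le t) le_rfl).aemeasurable
        (ae_of_all _ fun ω => hab t ht ω y))
      (fun y => ℱ.le _ _ (hX t ht y)) (hq t ht)
  have hazuma := hasSubgaussianMGF_sum_sub_condExp (μ := μ) hmeas fun t ht ω => hab t ht ω _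
  refine hazuma.neg.congr ?_
  filter_upwards [(ae_ball_iff (Finset.range T).countable_toSet).2 fun t ht =>
    hcond t (Finset.mem_range.1 ht)] with ω hω
  rw [Pi.neg_apply, ← Finset.sum_neg_distrib, transitionNoise]
  refine Finset.sum_congr rfl fun t ht => ?_
  rw [hω t ht, neg_sub]

end Noise

section Phases

theorem sum_phases_eq_sum_range {τ : ℕ → ℕ} (h0 : τ 0 = 0) (hτ : Monotone τ) (f : ℕ → ℝ) (n : ℕ) :
    ∑ k ∈ Finset.range n, ∑ t ∈ Finset.Ico (τ k) (τ (k + 1)), f t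
      = ∑ t ∈ Finset.range (τ n), f t := by
  induction n with
  | zero => simp [h0]
  | succ n ih =>
    rw [Finset.sum_range_succ, ih, Finset.range_eq_Ico, Finset.range_eq_Ico,
      Finset.sum_Ico_consecutive _ (Nat.zero_le _) (hτ n.le_succ)]

theorem sum_phases_increments_le {S : Type*} [Finite S] {τ : ℕ → ℕ} (hτ : Monotone τ)
    {β : ℕ → S → ℝ} {D : ℝ} {n : ℕ} (hspan : ∀ k < n, span (β k) ≤ D) (x : ℕ → S) :
    ∑ k ∈ Finset.range n, ∑ t ∈ Finset.Ico (τ k) (τ (k + 1)), (β k (x (t + 1)) - β k (x t))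
      ≤ D * n := by
  calc _ ≤ ∑ _k ∈ Finset.range n, D := Finset.sum_le_sum fun k hk => by
          rw [Finset.sum_Ico_sub (fun t => β k (x t)) (hτ k.le_succ)]
          exact (sub_le_span _ _ _).trans (hspan k (Finset.mem_range.1 hk))
    _ = D * n := by rw [Finset.sum_const, Finset.card_range, nsmul_eq_mul, mul_comm]

variable {S A Ω : Type*}

/-- The phase that contains the round `t`, found as the first phase that ends after round `t`
(`0` if there is none). -/
def phaseIndex (τ : ℕ → Ω → ℕ) (t : ℕ) (ω : Ω) : ℕ := sInf {k | t < τ (k + 1) ω}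

theorem phaseIndex_eq_iff {τ : ℕ → Ω → ℕ} {t n k : ℕ} {ω : Ω} (h0 : τ 0 ω = 0)
    (hτ : Monotone fun k => τ k ω) (hn : t < τ n ω) :
    phaseIndex τ t ω = k ↔ τ k ω ≤ t ∧ t < τ (k + 1) ω := by
  have hne : {k | t < τ (k + 1) ω}.Nonempty := ⟨n, hn.trans_le (hτ n.le_succ)⟩
  constructor
  · rintro rfl
    refine ⟨?_, Nat.sInf_mem hne⟩
    rcases hk : phaseIndex τ t ω with _ | j
    · exact h0.trans_le (Nat.zero_le t)
    · exact not_lt.1 (Nat.notMem_of_lt_sInf (s := {k | t < τ (k + 1) ω})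
        (j.lt_succ_self.trans_eq hk.symm))
  · rintro ⟨hstart, hend⟩
    refine le_antisymm (Nat.sInf_le hend) (le_csInf hne fun j hj => ?_)
    by_contra! hjk
    exact (hstart.trans_lt hj).not_ge (hτ hjk)

/-- `β` shifted to have minimum `0` and cut off at `D`. The cut-off changes nothing when
`span β ≤ D`, and it keeps the noise bounded outside the good event. -/
def clippedDual (D : ℝ) (β : S → ℝ) (x : S) : ℝ := min (β x - ⨅ y, β y) D

theorem measurable_clippedDual [Countable S] (D : ℝ) (x : S) :
    Measurable fun β : S → ℝ => clippedDual D β x :=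
  ((measurable_pi_apply x).sub (Measurable.iInf measurable_pi_apply)).min measurable_const

theorem clippedDual_mem_Icc [Finite S] {D : ℝ} (hD : 0 ≤ D) (β : S → ℝ) (x : S) :
    clippedDual D β x ∈ Set.Icc 0 D :=
  ⟨le_min (sub_nonneg.2 (ciInf_le (Set.finite_range β).bddBelow x)) hD, min_le_right _ _⟩

theorem clippedDual_eq_sub_iInf [Finite S] {D : ℝ} {β : S → ℝ} (hspan : span β ≤ D) (x : S) :
    clippedDual D β x = β x - ⨅ y, β y :=
  min_eq_left ((sub_le_sub_right (le_ciSup (Set.finite_range β).bddAbove x) _).trans hspan)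

theorem sum_mul_clippedDual_sub [Fintype S] {D : ℝ} {β p : S → ℝ} (hp : ∑ y, p y = 1)
    (hspan : span β ≤ D) (z : S) :
    ∑ y, p y * clippedDual D β y - clippedDual D β z = ∑ y, p y * β y - β z := by
  simp only [clippedDual_eq_sub_iInf hspan, mul_sub, Finset.sum_sub_distrib, ← Finset.sum_mul, hp]
  ring

namespace IsPhasedRun

variable [Fintype S] {mΩ : MeasurableSpace Ω} {μ : Measure Ω}
  {ℱ : Filtration ℕ mΩ} {M : MDP S A} {T : ℕ} {X : ℕ → Ω → S} {act : ℕ → Ω → A} {τ : ℕ → Ω → ℕ}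
  {m : Ω → ℕ} {π : ℕ → Ω → S → A} {β : ℕ → Ω → S → ℝ}

theorem phaseIndex_eq_iff (h : IsPhasedRun μ ℱ M T X act τ m π β) {t k : ℕ} (ht : t < T) (ω : Ω) :
    phaseIndex τ t ω = k ↔ τ k ω ≤ t ∧ t < τ (k + 1) ω :=
  AvgReward.phaseIndex_eq_iff (h.start ω) (h.mono ω) (ht.trans_eq (h.finish ω).symm)

theorem measurableSet_start_le (h : IsPhasedRun μ ℱ M T X act τ m π β) (k t : ℕ) :
    MeasurableSet[ℱ t] {ω | τ k ω ≤ t} := by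
  simpa only [ENat.some_eq_natCast, Nat.cast_le] using h.stopping k t

theorem measurable_dual_phaseIndex (h : IsPhasedRun μ ℱ M T X act τ m π β) {t : ℕ} (ht : t < T) :
    Measurable[ℱ t] fun ω => β (phaseIndex τ t ω) ω := by
  intro B hB
  have hset : (fun ω => β (phaseIndex τ t ω) ω) ⁻¹' B
      = ⋃ k, (β k ⁻¹' B ∩ {ω | τ k ω ≤ t}) ∩ {ω | τ (k + 1) ω ≤ t}ᶜ := by
    ext ω
    simp only [Set.mem_preimage, Set.mem_iUnion, Set.mem_inter_iff, Set.mem_compl_iff,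
      Set.mem_ofPred_eq, not_le, and_assoc, ← h.phaseIndex_eq_iff ht, exists_eq_right']
  rw [hset]
  refine MeasurableSet.iUnion fun k => MeasurableSet.inter ?_ (h.measurableSet_start_le _ t).compl
  have hβ := (((h.stopping k).measurableSet _).1 (h.dual_measurable k hB)).2 t
  simpa only [ENat.some_eq_natCast, Nat.cast_le] using hβ

theorem sum_range_eq_sum_phases (h : IsPhasedRun μ ℱ M T X act τ m π β) (f : ℕ → ℝ) (ω : Ω) :
    ∑ t ∈ Finset.range T, f t
      = ∑ k ∈ Finset.range (m ω), ∑ t ∈ Finset.Ico (τ k ω) (τ (k + 1) ω), f t := by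
  rw [sum_phases_eq_sum_range (h.start ω) (h.mono ω), h.finish ω]

theorem hasSubgaussianMGF_clippedDual_noise [IsProbabilityMeasure μ]
    (h : IsPhasedRun μ ℱ M T X act τ m π β) {D : ℝ} (hD : 0 ≤ D) :
    HasSubgaussianMGF (transitionNoise (fun t ω => M.P (X t ω) (act t ω))
      (fun t ω => clippedDual D (β (phaseIndex τ t ω) ω)) X T) (T * (‖D‖₊ / 2) ^ 2) μ := by
  have hnoise := hasSubgaussianMGF_transitionNoise (a := 0) (b := D)
    (V := fun t ω => clippedDual D (β (phaseIndex τ t ω) ω))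
    (fun t ht y => h.state_adapted (t + 1) ht y) h.transition
    (fun t ht y => (measurable_clippedDual D y).comp (h.measurable_dual_phaseIndex ht))
    (fun t _ ω y => clippedDual_mem_Icc hD _ y)
  rwa [sub_zero] at hnoise

theorem rounds_eq_zero_of_neg (h : IsPhasedRun μ ℱ M T X act τ m π β) {D : ℝ} {ω : Ω} (hD : D < 0)
    (hspan : ∀ k < m ω, span (β k ω) ≤ D) : T = 0 := by
  have : Nonempty S := ⟨X 0 ω⟩
  have hm : m ω = 0 := by
    by_contra hm
    exact ((span_nonneg _).trans (hspan 0 (Nat.pos_of_ne_zero hm))).not_gt hD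
  rw [← h.finish ω, hm, h.start ω]

end IsPhasedRun

end Phases

section Regret

variable {S A I Ω : Type*} [Fintype S] [DecidableEq S] [Fintype I] {mΩ : MeasurableSpace Ω}
  {μ : Measure Ω} {ℱ : Filtration ℕ mΩ} {M : MDP S A} {T : ℕ} {X : ℕ → Ω → S} {act : ℕ → Ω → A}
  {τ : ℕ → Ω → ℕ} {m : Ω → ℕ} {π : ℕ → Ω → S → A} {C : ℕ → Ω → ConfModel S A I}
  {β : ℕ → Ω → S → ℝ} {ρ : ℕ → Ω → ℝ} {D : ℝ}

namespace IsPhasedRun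

theorem regret_le (h : IsPhasedRun μ ℱ M T X act τ m π β) {ω : Ω} (hω : ω ∈ goodEvent M C m)
    (hdual : ∀ k < m ω, (C k ω).DualFeasible M.r (β k ω) (ρ k ω))
    (hpolicy : ∀ k < m ω, ∀ t ∈ Finset.Ico (τ k ω) (τ (k + 1) ω),
      (C k ω).OptimalAction M.r (β k ω) (ρ k ω) (X t ω) (π k ω (X t ω)))
    (hspan : ∀ k < m ω, span (β k ω) ≤ D) :
    regret M T X act ω ≤ phaseSum X τ m π (fun k ω => (C k ω).CB (β k ω)) ω
      + phaseSum X τ m π (fun k ω => (C k ω).CP M.P (β k ω)) ω + D * m ω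
      + transitionNoise (fun t ω => M.P (X t ω) (act t ω))
          (fun t ω => clippedDual D (β (phaseIndex τ t ω) ω)) X T ω := by
  have hround : ∀ k ∈ Finset.range (m ω), ∀ t ∈ Finset.Ico (τ k ω) (τ (k + 1) ω),
      M.optGain - M.r (X t ω) (act t ω)
        ≤ (C k ω).CB (β k ω) (X t ω) (π k ω (X t ω))
          + (C k ω).CP M.P (β k ω) (X t ω) (π k ω (X t ω))
          + (β k ω (X (t + 1) ω) - β k ω (X t ω))
          + (∑ y, M.P (X t ω) (act t ω) y * clippedDual D (β (phaseIndex τ t ω) ω) y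
            - clippedDual D (β (phaseIndex τ t ω) ω) (X (t + 1) ω)) := fun k hk t ht => by
    have hkm := Finset.mem_range.1 hk
    have htT : t < T :=
      ((Finset.mem_Ico.1 ht).2.trans_le (h.mono ω hkm)).trans_eq (h.finish ω)
    have hbellman := (hdual k hkm).optGain_sub_reward_le (hω k hkm) (hpolicy k hkm t ht)
    rw [(h.phaseIndex_eq_iff htT ω).2 (Finset.mem_Ico.1 ht), h.act_eq ω k hkm t ht,
      sum_mul_clippedDual_sub (M.isTransition.2 _ _) (hspan k hkm)]
    linarith
  have hsum := Finset.sum_le_sum fun k hk => Finset.sum_le_sum (hround k hk)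
  rw [regret, transitionNoise, h.sum_range_eq_sum_phases _ ω, h.sum_range_eq_sum_phases _ ω,
    phaseSum, phaseSum]
  refine hsum.trans ?_
  simp only [Finset.sum_add_distrib]
  gcongr
  exact sum_phases_increments_le (h.mono ω) hspan (X · ω)

theorem measure_regret_gt_le [IsProbabilityMeasure μ] (h : IsPhasedRun μ ℱ M T X act τ m π β)
    (hdual : ∀ ω ∈ goodEvent M C m, ∀ k < m ω, (C k ω).DualFeasible M.r (β k ω) (ρ k ω))
    (hpolicy : ∀ ω ∈ goodEvent M C m, ∀ k < m ω, ∀ t ∈ Finset.Ico (τ k ω) (τ (k + 1) ω),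
      (C k ω).OptimalAction M.r (β k ω) (ρ k ω) (X t ω) (π k ω (X t ω)))
    (hspan : ∀ ω ∈ goodEvent M C m, ∀ k < m ω, span (β k ω) ≤ D) {L : ℝ} (hL : 0 ≤ L) :
    μ {ω | ω ∈ goodEvent M C m ∧ ¬ (regret M T X act ω ≤
        phaseSum X τ m π (fun k ω => (C k ω).CB (β k ω)) ω
        + phaseSum X τ m π (fun k ω => (C k ω).CP M.P (β k ω)) ω + D * m ω + D * √(T * L))}
      ≤ ENNReal.ofReal (Real.exp (-(2 * L))) := by
  have hreg := fun ω hω => h.regret_le hω (hdual ω hω) (hpolicy ω hω) (hspan ω hω)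
  rcases lt_or_ge D 0 with hD | hD
  · refine (measure_mono_null (t := ∅) ?_ measure_empty).trans_le zero_le
    rintro ω ⟨hω, hfail⟩
    refine hfail ?_
    obtain rfl := h.rounds_eq_zero_of_neg hD (hspan ω hω)
    simpa only [transitionNoise, Finset.range_zero, Finset.sum_empty, Nat.cast_zero, zero_mul,
      Real.sqrt_zero, mul_zero] using hreg ω hω
  · have hsqrt : √(2 * ((T * (‖D‖₊ / 2) ^ 2 : NNReal) : ℝ) * (2 * L)) = D * √(T * L) := by
      nth_rw 2 [← Real.sqrt_sq hD]
      rw [← Real.sqrt_mul (sq_nonneg D)]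
      push_cast
      rw [Real.norm_of_nonneg hD]
      ring_nf
    refine (measure_mono ?_).trans
      (measure_sqrt_lt_le (h.hasSubgaussianMGF_clippedDual_noise hD) (mul_nonneg zero_le_two hL))
    rintro ω ⟨hω, hfail⟩
    change √_ < transitionNoise _ _ X T ω
    rw [hsqrt]
    linarith [not_le.1 hfail, hreg ω hω]

end IsPhasedRun

theorem exp_neg_two_mul_log {x : ℝ} (hx : x ≠ 0) :
    Real.exp (-(2 * Real.log x)) = (x ^ 2)⁻¹ := by
  rw [Real.exp_neg, ← Nat.cast_two, ← Real.log_pow, Real.exp_log (sq_pos_of_ne_zero hx)]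

theorem mainTheorem10_general [IsProbabilityMeasure μ] (h : IsPhasedRun μ ℱ M T X act τ m π β)
    (hdual : ∀ ω ∈ goodEvent M C m, ∀ k < m ω, (C k ω).DualFeasible M.r (β k ω) (ρ k ω))
    (hpolicy : ∀ ω ∈ goodEvent M C m, ∀ k < m ω, ∀ t ∈ Finset.Ico (τ k ω) (τ (k + 1) ω),
      (C k ω).OptimalAction M.r (β k ω) (ρ k ω) (X t ω) (π k ω (X t ω)))
    (hspan : ∀ ω ∈ goodEvent M C m, ∀ k < m ω, span (β k ω) ≤ D) :
    (∀ δ : ℝ, 1 ≤ 2 * δ * (T : ℝ) ^ 2 →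
      μ {ω | ω ∈ goodEvent M C m ∧ ¬ (regret M T X act ω ≤
        phaseSum X τ m π (fun k ω => (C k ω).CB (β k ω)) ω
        + phaseSum X τ m π (fun k ω => (C k ω).CP M.P (β k ω)) ω
        + D * m ω + D * √(T * Real.log T))} ≤ ENNReal.ofReal (2 * δ)) ∧
    (∀ δ : ℝ, 0 < δ → δ < 1 →
      μ {ω | ω ∈ goodEvent M C m ∧ ¬ (regret M T X act ω ≤
        phaseSum X τ m π (fun k ω => (C k ω).CB (β k ω)) ω
        + phaseSum X τ m π (fun k ω => (C k ω).CP M.P (β k ω)) ω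
        + D * m ω + D * √(T * Real.log (1 / δ)))} ≤ ENNReal.ofReal (2 * δ)) := by
  have hbound {L : ℝ} (hL : 0 ≤ L) := h.measure_regret_gt_le hdual hpolicy hspan hL
  refine ⟨fun δ hδ => (hbound (Real.log_natCast_nonneg T)).trans (ENNReal.ofReal_le_ofReal ?_),
    fun δ h0 h1 => (hbound (Real.log_nonneg ((one_le_div h0).2 h1.le))).trans
      (ENNReal.ofReal_le_ofReal ?_)⟩
  · have hT : (T : ℝ) ≠ 0 := fun hT => by norm_num [hT] at hδ
    rw [exp_neg_two_mul_log hT, inv_le_iff_one_le_mul₀ (by positivity)]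
    exact hδ
  · rw [exp_neg_two_mul_log (one_div_ne_zero h0.ne'), one_div, inv_pow, inv_inv]
    nlinarith

end Regret

end AvgReward

end

theorem mainTheorem10 {S A I Ω : Type*} [Fintype S] [DecidableEq S] [Nonempty S]
    [Fintype A] [Nonempty A] [Fintype I] {mΩ : MeasurableSpace Ω}
    (μ : MeasureTheory.Measure Ω) [MeasureTheory.IsProbabilityMeasure μ]
    (ℱ : MeasureTheory.Filtration ℕ mΩ) (M : AvgReward.MDP S A) (T : ℕ)
    (X : ℕ → Ω → S) (act : ℕ → Ω → A) (τ : ℕ → Ω → ℕ) (m : Ω → ℕ)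
    (π : ℕ → Ω → S → A) (C : ℕ → Ω → AvgReward.ConfModel S A I)
    (β : ℕ → Ω → S → ℝ) (ρ : ℕ → Ω → ℝ) (D : ℝ)
    (hrun : AvgReward.IsPhasedRun μ ℱ M T X act τ m π β)
    -- `(β k, ρ k)` is an optimal solution of the dual program of phase `k`
    (hdual : ∀ ω ∈ AvgReward.goodEvent M C m, ∀ k < m ω,
      (C k ω).DualOptimal M.r (β k ω) (ρ k ω))
    -- the policy `π k` satisfies the optimality equation in the states visited in phase `k`
    (hpolicy : ∀ ω ∈ AvgReward.goodEvent M C m, ∀ k < m ω,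
      ∀ t ∈ Finset.Ico (τ k ω) (τ (k + 1) ω),
        (C k ω).OptimalAction M.r (β k ω) (ρ k ω) (X t ω) (π k ω (X t ω)))
    (hspan : ∀ ω ∈ AvgReward.goodEvent M C m, ∀ k < m ω, AvgReward.span (β k ω) ≤ D) :
    (∀ δ : ℝ, 1 ≤ 2 * δ * (T : ℝ) ^ 2 →
      μ {ω | ω ∈ AvgReward.goodEvent M C m ∧
        ¬ (AvgReward.regret M T X act ω ≤
            AvgReward.phaseSum X τ m π (fun k ω => (C k ω).CB (β k ω)) ω
            + AvgReward.phaseSum X τ m π (fun k ω => (C k ω).CP M.P (β k ω)) ω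
            + D * m ω + D * √(T * Real.log T))} ≤ ENNReal.ofReal (2 * δ)) ∧
    (∀ δ : ℝ, 0 < δ → δ < 1 →
      μ {ω | ω ∈ AvgReward.goodEvent M C m ∧
        ¬ (AvgReward.regret M T X act ω ≤
            AvgReward.phaseSum X τ m π (fun k ω => (C k ω).CB (β k ω)) ω
            + AvgReward.phaseSum X τ m π (fun k ω => (C k ω).CP M.P (β k ω)) ω
            + D * m ω + D * √(T * Real.log (1 / δ)))} ≤ ENNReal.ofReal (2 * δ)) :=
  AvgReward.mainTheorem10_general hrun (fun ω hω k hk => (hdual ω hω k hk).1) hpolicy hspan
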